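/- For a permutation $\pi=\pi_1\cdots\pi_n$ of $\{1,\ldots,n\}$ and a permutation $\tau=\tau_1\cdots\tau_k$ of $\{1,\ldots,k\}$, say that $\pi$ contains the pattern $\tau$ if there are indices $1\le i_1<\cdots<i_k\le n$ such that $\pi_{i_1}\cdots\pi_{i_k}$ is in the same relative order as $\tau_1\cdots\tau_k$; otherwise $\pi$ avoids $\tau$. For a collection $T$ of patterns, let $S_n(T)$ be the set of permutations of $\{1,\ldots,n\}$ avoiding every pattern in $T$. For $k\ge 2$ let $213\cdots k$ be the permutation obtained from $12\cdots k$ by interchanging its first two letters (so it is $21$ for $k=2$); for $k=1$ let it be the permutation $1$. For every $n\ge 0$ there is a bijection $\omega: S_n(1243,2143)\to S_n(1243,2143)$ such that, for all $k\ge 1$ and all $\pi\in S_n(1243,2143)$, the permutation $\pi$ avoids $12\cdots k$ if and only if $\omega(\pi)$ avoids $213\cdots k$. In particular, $\{1243,2143,12\cdots k\}$ and $\{1243,2143,213\cdots k\}$ are Wilf-equivalent for every $k\ge 1$, that is, $|S_n(1243,2143,12\cdots k)|=|S_n(1243,2143,213\cdots k)|$ for all $n\ge 0$. -/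

import Mathlib

/-- The permutation `π = π₁ ⋯ πₙ` contains the pattern `τ = τ₁ ⋯ τₖ`: there are positions
`i₁ < i₂ < ⋯ < iₖ` such that `π_{i₁} π_{i₂} ⋯ π_{iₖ}` is in the same relative order as
`τ₁ τ₂ ⋯ τₖ`. Permutations of `{1, …, n}` are modelled by permutations of `Fin n = {0, …, n-1}`. -/
def ContainsPattern {n k : ℕ} (π : Equiv.Perm (Fin n)) (τ : Equiv.Perm (Fin k)) : Prop :=
  ∃ i : Fin k → Fin n, StrictMono i ∧ ∀ a b : Fin k, π (i a) < π (i b) ↔ τ a < τ b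

/-- The permutation `π` avoids the pattern `τ`. -/
def AvoidsPattern {n k : ℕ} (π : Equiv.Perm (Fin n)) (τ : Equiv.Perm (Fin k)) : Prop :=
  ¬ ContainsPattern π τ

/-- A pattern is a permutation of `{1, …, k}` for some length `k`. -/
abbrev Pattern : Type := Σ k : ℕ, Equiv.Perm (Fin k)

/-- `Sₙ(T)`: the permutations of `{1, …, n}` that avoid each pattern in the collection `T`. -/
def permsAvoiding (n : ℕ) (T : Set Pattern) : Set (Equiv.Perm (Fin n)) :=
  {π | ∀ τ ∈ T, AvoidsPattern π τ.2}

/-- Two collections of patterns are Wilf-equivalent if, for every `n`, they are avoided by the same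
number of permutations of `{1, …, n}`. -/
def WilfEquivalent (T T' : Set Pattern) : Prop :=
  ∀ n : ℕ, (permsAvoiding n T).ncard = (permsAvoiding n T').ncard

/-- The pattern `1243`. -/
def pattern1243 : Equiv.Perm (Fin 4) := Equiv.swap 2 3

/-- The pattern `2143`. -/
def pattern2143 : Equiv.Perm (Fin 4) := Equiv.swap 0 1 * Equiv.swap 2 3

/-- The pattern `12⋯k`. -/
def patternIncreasing (k : ℕ) : Equiv.Perm (Fin k) := 1

/-- The pattern `213⋯k`, obtained from `12⋯k` by interchanging the letters `1` and `2`; thus it is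
`21` for `k = 2`. For `k = 1`, where there is nothing to interchange, it is the pattern `1`. -/
def pattern213 (k : ℕ) : Equiv.Perm (Fin k) :=
  if h : 2 ≤ k then Equiv.swap ⟨0, by omega⟩ ⟨1, by omega⟩ else 1

/-- The collection `{1243, 2143}`. A Schröder permutation is one that avoids both patterns, that is,
an element of `permsAvoiding n schroederPatterns`. -/
def schroederPatterns : Set Pattern := {⟨4, pattern1243⟩, ⟨4, pattern2143⟩}

theorem pattern1243_word : ⇑pattern1243 = ![0, 1, 3, 2] := by decide

theorem pattern2143_word : ⇑pattern2143 = ![1, 0, 3, 2] := by decide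

/-! Split a Schröder word at its maximum M as l₁ M l₂. Two letters of l₁ below the same letter z of
l₂ would form 1243 or 2143 with M and z, so only the least letter a of l₁ can lie below letters of
l₂. For nonempty l₁ the word thus amounts to two independent Schröder words that share a: l₁, up to
relative order, and a l₂ (`perm_range_of_append_max_cons`; `glue` is the inverse).

Consider a pattern made of Q followed by a new largest letter. Since M can serve as that letter, the
word contains the pattern iff l₁ contains Q or a l₂ contains the whole pattern
(`hasSubword_appendTop_append_max_cons_iff`). This yields a recursion (`card_avoiders_succ`) by
which the counts for the extended pattern depend on Q only through the counts for Q
(`card_avoiders_appendTop_congr`). Both 12⋯k and 213⋯k arise by repeated extension from 12 and 21,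
which are exchanged by reversal.

For the bijection, note that in each family avoidance at k implies avoidance at k + 1 and is
automatic for k > n. Equal counts for all k therefore mean that the least avoided k is equally
distributed in both families, and a bijection matching these values serves all k at once
(`exists_equiv_of_card_eq`). -/

/-- A word avoiding `1243` and `2143`. -/
def SchroederWord (l : List ℕ) : Prop :=
  ∀ x y d c, [x, y, d, c].Sublist l → x < c → y < c → ¬ c < d

/-- Some subword of `l` satisfies `Q`. -/
def HasSubword (Q : List ℕ → Prop) (l : List ℕ) : Prop := ∃ s, s.Sublist l ∧ Q s

/-- The words obtained from a word satisfying `Q` by appending a letter larger than all others. -/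
def AppendTop (Q : List ℕ → Prop) (s : List ℕ) : Prop :=
  ∃ t z, s = t ++ [z] ∧ Q t ∧ ∀ x ∈ t, x < z

/-- The predicate `Q` on words depends on the relative order of the letters only. -/
def OrderInvariant (Q : List ℕ → Prop) : Prop :=
  ∀ (s : List ℕ) (f : ℕ → ℕ), StrictMonoOn f {x | x ∈ s} → (Q (s.map f) ↔ Q s)

theorem OrderInvariant.appendTop {Q : List ℕ → Prop} (hQ : OrderInvariant Q) :
    OrderInvariant (AppendTop Q) := by
  intro s f hf
  constructor
  · rintro ⟨t, z, h, hQt, hlt⟩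
    obtain ⟨t', r, rfl, rfl, hr⟩ := List.map_eq_append_iff.1 h
    obtain ⟨z', rfl, rfl⟩ := List.map_eq_singleton_iff.1 hr
    refine ⟨t', z', rfl, (hQ t' f (hf.mono ?_)).1 hQt, fun x hx => ?_⟩
    · intro x hx
      simp only [Set.mem_ofPred_eq, List.mem_append] at hx ⊢
      exact Or.inl hx
    · exact (hf.lt_iff_lt (by simp [hx]) (by simp)).1 (hlt _ (List.mem_map_of_mem hx))
  · rintro ⟨t, z, rfl, hQt, hlt⟩
    refine ⟨t.map f, f z, by simp, (hQ t f (hf.mono ?_)).2 hQt, fun x hx => ?_⟩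
    · intro x hx
      simp only [Set.mem_ofPred_eq, List.mem_append] at hx ⊢
      exact Or.inl hx
    · obtain ⟨y, hy, rfl⟩ := List.mem_map.1 hx
      exact hf (by simp [hy]) (by simp) (hlt y hy)

theorem HasSubword.mono {Q : List ℕ → Prop} {l l' : List ℕ} (h : l.Sublist l')
    (hl : HasSubword Q l) : HasSubword Q l' := by
  obtain ⟨s, hs, hQ⟩ := hl
  exact ⟨s, hs.trans h, hQ⟩

theorem SchroederWord.of_sublist {l l' : List ℕ} (h : l.Sublist l') (hl : SchroederWord l') :
    SchroederWord l :=
  fun x y d c hs => hl x y d c (hs.trans h)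

theorem hasSubword_map_iff {Q : List ℕ → Prop} (hQ : OrderInvariant Q) {l : List ℕ} {f : ℕ → ℕ}
    (hf : StrictMonoOn f {x | x ∈ l}) : HasSubword Q (l.map f) ↔ HasSubword Q l := by
  constructor
  · rintro ⟨s, hs, hQs⟩
    obtain ⟨t, ht, rfl⟩ := List.sublist_map_iff.1 hs
    exact ⟨t, ht, (hQ t f (hf.mono fun x hx => ht.subset hx)).1 hQs⟩
  · rintro ⟨s, hs, hQs⟩
    exact ⟨s.map f, hs.map f, (hQ s f (hf.mono fun x hx => hs.subset hx)).2 hQs⟩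

theorem schroederWord_map_iff {l : List ℕ} {f : ℕ → ℕ}
    (hf : StrictMonoOn f {x | x ∈ l}) : SchroederWord (l.map f) ↔ SchroederWord l := by
  constructor
  · intro h x y d c hs hx hy hd
    have hm := hs.subset
    simp only [List.subset_def, List.mem_cons, List.not_mem_nil, or_false, forall_eq_or_imp,
      forall_eq] at hm
    obtain ⟨mx, my, md, mc⟩ := hm
    exact h (f x) (f y) (f d) (f c) (hs.map f) (hf mx mc hx) (hf my mc hy) (hf mc md hd)
  · intro h x y d c hs hx hy hd
    obtain ⟨t, ht, hte⟩ := List.sublist_map_iff.1 hs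
    match t, ht, hte with
    | [x', y', d', c'], ht, hte =>
      simp only [List.map_cons, List.map_nil, List.cons.injEq, and_true] at hte
      obtain ⟨rfl, rfl, rfl, rfl⟩ := hte
      have hm := ht.subset
      simp only [List.subset_def, List.mem_cons, List.not_mem_nil, or_false, forall_eq_or_imp,
        forall_eq] at hm
      obtain ⟨mx, my, md, mc⟩ := hm
      exact h _ _ _ _ ht ((hf.lt_iff_lt mx mc).1 hx) ((hf.lt_iff_lt my mc).1 hy)
        ((hf.lt_iff_lt mc md).1 hd)

/-! ### Splitting a word at its maximum -/

theorem schroederWord_max_cons_iff {M : ℕ} {l : List ℕ} (hM : ∀ x ∈ l, x < M) :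
    SchroederWord (M :: l) ↔ SchroederWord l := by
  refine ⟨fun h => h.of_sublist (List.sublist_cons_self _ _), fun h x y d c hs hx hy hd => ?_⟩
  rcases List.sublist_cons_iff.1 hs with hs | ⟨r, hr, hs⟩
  · exact h x y d c hs hx hy hd
  · simp only [List.cons.injEq] at hr
    obtain ⟨rfl, rfl⟩ := hr
    exact absurd (hM c (hs.subset (by simp))) (by omega)

/-- A leading maximum could only be the top letter of an occurrence, with nothing before it; `¬ Q
[]` excludes this. -/
theorem hasSubword_appendTop_max_cons_iff {Q : List ℕ → Prop} (hne : ¬ Q []) {M : ℕ} {l : List ℕ}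
    (hM : ∀ x ∈ l, x < M) :
    HasSubword (AppendTop Q) (M :: l) ↔ HasSubword (AppendTop Q) l := by
  refine ⟨?_, HasSubword.mono (List.sublist_cons_self _ _)⟩
  rintro ⟨s, hs, t, z, rfl, hQ, hlt⟩
  rcases List.sublist_cons_iff.1 hs with hs | ⟨r, hr, hs⟩
  · exact ⟨_, hs, t, z, rfl, hQ, hlt⟩
  · cases t with
    | nil => exact absurd hQ hne
    | cons b t =>
      simp only [List.cons_append, List.cons.injEq] at hr
      obtain ⟨rfl, rfl⟩ := hr
      have h1 := hM z (hs.subset (by simp))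
      have h2 := hlt b (by simp)
      omega

section Decomposition

variable {M a : ℕ} {l₁ l₂ : List ℕ}

theorem schroederWord_append_max_cons_iff (hnd : l₁.Nodup) (ha : a ∈ l₁)
    (hM : ∀ x ∈ l₂, x < M) (hlow : ∀ x ∈ l₁, ∀ z ∈ l₂, x < z → x = a) (hM₁ : ∀ x ∈ l₁, x < M) :
    SchroederWord (l₁ ++ M :: l₂) ↔ SchroederWord l₁ ∧ SchroederWord (a :: l₂) := by
  refine ⟨fun h => ⟨h.of_sublist (List.sublist_append_left _ _), h.of_sublist ?_⟩, ?_⟩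
  · exact (List.singleton_sublist.2 ha).append (List.sublist_cons_self M l₂)
  rintro ⟨h₁, h₂⟩ x y d c hs hx hy hd
  obtain ⟨u, v, huv, hu, hv⟩ := List.sublist_append_iff.1 hs
  match u, huv, hu with
  | [], huv, hu =>
    simp only [List.nil_append] at huv
    subst huv
    rcases List.sublist_cons_iff.1 hv with hv | ⟨r, hr, hv⟩
    · exact h₂ x y d c (hv.trans (List.sublist_cons_self _ _)) hx hy hd
    · simp only [List.cons.injEq] at hr
      obtain ⟨rfl, rfl⟩ := hr
      exact absurd (hM c (hv.subset (by simp))) (by omega)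
  | [x'], huv, hu =>
    simp only [List.cons_append, List.nil_append, List.cons.injEq] at huv
    obtain ⟨rfl, rfl⟩ := huv
    rcases List.sublist_cons_iff.1 hv with hv | ⟨r, hr, hv⟩
    · obtain rfl := hlow x (List.singleton_sublist.1 hu) c (hv.subset (by simp)) hx
      exact h₂ x y d c (hv.cons_cons x) hx hy hd
    · simp only [List.cons.injEq] at hr
      obtain ⟨rfl, rfl⟩ := hr
      exact absurd (hM c (hv.subset (by simp))) (by omega)
  | x' :: y' :: u, huv, hu =>
    simp only [List.cons_append, List.cons.injEq] at huv
    obtain ⟨rfl, rfl, huv⟩ := huv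
    match v, huv, hv with
    | [], huv, hv =>
      simp only [List.append_nil] at huv
      subst huv
      exact h₁ x y d c hu hx hy hd
    | e :: v, huv, hv =>
      -- The part right of the cut is nonempty, so it contains the last letter `c`.
      have hc : c ∈ e :: v := by
        have := congrArg List.getLast? huv
        rw [List.getLast?_append] at this
        simp only [List.getLast?_cons_cons, List.getLast?_singleton] at this
        rw [List.getLast?_eq_getLast_of_ne_nil (List.cons_ne_nil e v)] at this
        simp only [Option.some_or, Option.some.injEq] at this
        rw [this]
        exact List.getLast_mem _
      rcases List.mem_cons.1 (hv.subset hc) with rfl | hc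
      · have hdm := hs.subset (show d ∈ [x, y, d, c] by simp)
        simp only [List.mem_append, List.mem_cons] at hdm
        rcases hdm with h | h | h
        · exact absurd (hM₁ d h) (by omega)
        · omega
        · exact absurd (hM d h) (by omega)
      · have e₁ := hlow x (hu.subset (by simp)) c hc hx
        have e₂ := hlow y (hu.subset (by simp)) c hc hy
        have := hu.nodup hnd
        simp [e₁, e₂] at this

theorem hasSubword_appendTop_append_max_cons_iff {Q : List ℕ → Prop} (hnd : l₁.Nodup) (ha : a ∈ l₁)
    (hM : ∀ x ∈ l₂, x < M) (hlow : ∀ x ∈ l₁, ∀ z ∈ l₂, x < z → x = a) (hM₁ : ∀ x ∈ l₁, x < M) :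
    HasSubword (AppendTop Q) (l₁ ++ M :: l₂) ↔
      HasSubword Q l₁ ∨ HasSubword (AppendTop Q) (a :: l₂) := by
  constructor
  · rintro ⟨s, hs, t, z, rfl, hQ, hlt⟩
    obtain ⟨u, v, huv, hu, hv⟩ := List.sublist_append_iff.1 hs
    rcases List.eq_nil_or_concat v with rfl | ⟨v, z', rfl⟩
    · rw [List.append_nil] at huv
      subst huv
      exact Or.inl ⟨t, (List.sublist_append_left _ _).trans hu, hQ⟩
    rw [List.concat_eq_append] at huv hv
    rw [← List.append_assoc] at huv
    obtain ⟨rfl, hz⟩ := List.append_inj' huv rfl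
    simp only [List.cons.injEq, and_true] at hz
    subst hz
    rcases List.sublist_cons_iff.1 hv with hv' | ⟨r, hr, hv'⟩
    · right
      have hzl : z ∈ l₂ := hv'.subset (by simp)
      -- The letters of `u` are below `z ∈ l₂`, hence all equal to `a`, and there are no
      -- repetitions.
      have hua : u.Sublist [a] := by
        have h1 : ∀ x ∈ u, x = a := fun x hx =>
          hlow x (hu.subset hx) z hzl (hlt x (List.mem_append_left _ hx))
        have h2 := hu.nodup hnd
        match u, h1, h2 with
        | [], _, _ => simp
        | [x], h1, _ => simp [h1 x (by simp)]
        | x :: y :: u, h1, h2 =>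
          simp [h1 x (by simp), h1 y (by simp)] at h2
      refine ⟨_, ?_, u ++ v, z, rfl, hQ, hlt⟩
      rw [List.append_assoc]
      exact hua.append hv'
    · left
      cases v with
      | nil => exact ⟨u, hu, by simpa using hQ⟩
      | cons b v =>
        simp only [List.cons_append, List.cons.injEq] at hr
        obtain ⟨rfl, rfl⟩ := hr
        have h1 := hM z (hv'.subset (by simp))
        have h2 := hlt b (by simp)
        omega
  · rintro (⟨s, hs, hQ⟩ | h)
    · exact ⟨s ++ [M], hs.append (List.singleton_sublist.2 (by simp)), s, M, rfl, hQ,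
        fun x hx => hM₁ x (hs.subset hx)⟩
    · exact h.mono ((List.singleton_sublist.2 ha).append (List.sublist_cons_self M l₂))

end Decomposition

/-! ### Enumeration by the position of the maximum -/

open Classical in
/-- The words on `{0, …, n-1}` that avoid `1243`, `2143` and all the words satisfying `Q`. -/
noncomputable def avoiders (n : ℕ) (Q : List ℕ → Prop) : Finset (List ℕ) :=
  {l ∈ (List.range n).permutations.toFinset | SchroederWord l ∧ ¬ HasSubword Q l}

theorem mem_avoiders {n : ℕ} {Q : List ℕ → Prop} {l : List ℕ} :
    l ∈ avoiders n Q ↔ l.Perm (List.range n) ∧ SchroederWord l ∧ ¬ HasSubword Q l := by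
  simp [avoiders]

theorem perm_range_iff {n : ℕ} {l : List ℕ} :
    l.Perm (List.range n) ↔ l.Nodup ∧ ∀ x, x ∈ l ↔ x < n := by
  constructor
  · intro h
    exact ⟨h.nodup_iff.2 List.nodup_range, fun x => by rw [h.mem_iff, List.mem_range]⟩
  · rintro ⟨h, hm⟩
    rw [List.perm_ext_iff_of_nodup h List.nodup_range]
    intro x
    rw [hm, List.mem_range]

theorem perm_range_of_lt {n : ℕ} {l : List ℕ} (h : l.Nodup) (hlt : ∀ x ∈ l, x < n)
    (hlen : l.length = n) : l.Perm (List.range n) := by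
  refine (List.Nodup.subperm h fun x hx => List.mem_range.2 (hlt x hx)).perm_of_length_le ?_
  simp [hlen]

theorem card_avoiders_max_first {Q : List ℕ → Prop} (hne : ¬ Q []) (n : ℕ) :
    ({l ∈ avoiders (n + 1) (AppendTop Q) | l.idxOf n = 0} : Finset _).card =
      (avoiders n (AppendTop Q)).card := by
  symm
  refine Finset.card_bij (fun l _ => n :: l) ?_ ?_ ?_
  · intro l hl
    obtain ⟨hp, hs, hq⟩ := mem_avoiders.1 hl
    have hlt : ∀ x ∈ l, x < n := fun x => ((perm_range_iff.1 hp).2 x).1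
    simp only [Finset.mem_filter, mem_avoiders, List.idxOf_cons_self, and_true]
    refine ⟨?_, (schroederWord_max_cons_iff hlt).2 hs,
      mt (hasSubword_appendTop_max_cons_iff hne hlt).1 hq⟩
    rw [List.range_succ]
    exact (hp.cons n).trans (List.perm_append_singleton _ _).symm
  · intro l _ l' _ h
    exact (List.cons.inj h).2
  · intro l hl
    simp only [Finset.mem_filter, mem_avoiders] at hl
    obtain ⟨⟨hp, hs, hq⟩, hi⟩ := hl
    have hn : n ∈ l := ((perm_range_iff.1 hp).2 n).2 (by omega)
    match l, hi, hn with
    | b :: l, hi, hn =>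
      obtain rfl : b = n := by
        by_contra hb
        rw [List.idxOf_cons_ne _ hb] at hi
        omega
      have hp' : l.Perm (List.range b) := by
        rw [List.range_succ] at hp
        exact (hp.trans (List.perm_append_singleton _ _)).cons_inv
      have hlt : ∀ x ∈ l, x < b := fun x => ((perm_range_iff.1 hp').2 x).1
      exact ⟨l, mem_avoiders.2 ⟨hp', (schroederWord_max_cons_iff hlt).1 hs,
        mt (hasSubword_appendTop_max_cons_iff hne hlt).2 hq⟩, rfl⟩

/-- The map that replaces the letter `0` by `a` and adds `j` to the other letters. -/
def spread (j a x : ℕ) : ℕ := if x = 0 then a else x + j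

theorem spread_strictMono {j a : ℕ} (h : a ≤ j) : StrictMono (spread j a) := by
  intro x y hxy
  unfold spread
  split_ifs <;> omega

/-- Truncated subtraction sends `a` back to `0` because `a ≤ j`; the inverse thus does not depend on
`a`. -/
theorem spread_sub {j a x : ℕ} (h : a ≤ j) : spread j a x - j = x := by
  unfold spread
  split_ifs <;> omega

/-- Glue two words along the least letter of the first and the first letter of the second, and
separate them by a new maximum. -/
def glue (i j : ℕ) (p q : List ℕ) : List ℕ :=
  p.map (spread j (q.headD 0)) ++ (i + j + 1) :: q.tail

/-- These are the hypotheses of the decomposition lemmas. They hold since `spread` puts every letter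
of `p` other than `0` above `j`, while the letters of `t` are at most `j`. -/
theorem append_max_cons_conditions {i j a : ℕ} {p t : List ℕ} (hp : p.Perm (List.range (i + 1)))
    (hq : (a :: t).Perm (List.range (j + 1))) :
    (p.map (spread j a)).Nodup ∧ a ∈ p.map (spread j a) ∧ (∀ x ∈ t, x < i + j + 1) ∧
      (∀ x ∈ p.map (spread j a), ∀ z ∈ t, x < z → x = a) ∧
      (∀ x ∈ p.map (spread j a), x < i + j + 1) := by
  obtain ⟨hpn, hpm⟩ := perm_range_iff.1 hp
  obtain ⟨hqn, hqm⟩ := perm_range_iff.1 hq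
  have haj : a ≤ j := by have := (hqm a).1 (by simp); omega
  have ht : ∀ x ∈ t, x < j + 1 := fun x hx => (hqm x).1 (List.mem_cons_of_mem _ hx)
  refine ⟨hpn.map (spread_strictMono haj).injective, ?_, ?_, ?_, ?_⟩
  · exact List.mem_map.2 ⟨0, (hpm 0).2 (by omega), by simp [spread]⟩
  · intro x hx
    have := ht x hx
    omega
  · intro x hx z hz hxz
    obtain ⟨y, hy, rfl⟩ := List.mem_map.1 hx
    have := ht z hz
    unfold spread at hxz ⊢
    split_ifs at hxz ⊢
    · rfl
    · omega
  · intro x hx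
    obtain ⟨y, hy, rfl⟩ := List.mem_map.1 hx
    have := (hpm y).1 hy
    unfold spread
    split_ifs <;> omega

theorem glue_perm {i j a : ℕ} {p t : List ℕ} (hp : p.Perm (List.range (i + 1)))
    (hq : (a :: t).Perm (List.range (j + 1))) :
    (glue i j p (a :: t)).Perm (List.range (i + j + 1 + 1)) := by
  obtain ⟨h₁, -, h₃, h₄, h₅⟩ := append_max_cons_conditions hp hq
  obtain ⟨hpn, hpm⟩ := perm_range_iff.1 hp
  obtain ⟨hqn, hqm⟩ := perm_range_iff.1 hq
  have haj : a ≤ j := by have := (hqm a).1 (by simp); omega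
  rw [List.nodup_cons] at hqn
  refine perm_range_of_lt ?_ ?_ ?_
  · simp only [glue, List.headD_cons, List.tail_cons]
    rw [List.nodup_append, List.nodup_cons]
    refine ⟨h₁, ⟨fun h => absurd (h₃ _ h) (by omega), hqn.2⟩, ?_⟩
    rintro x hx y hy rfl
    rcases List.mem_cons.1 hy with rfl | hy
    · exact absurd (h₅ _ hx) (by omega)
    · obtain ⟨z, hz, rfl⟩ := List.mem_map.1 hx
      have h6 := (hqm _).1 (List.mem_cons_of_mem _ hy)
      unfold spread at h6 hy
      split_ifs at h6 hy
      · exact hqn.1 hy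
      · omega
  · intro x hx
    simp only [glue, List.headD_cons, List.tail_cons, List.mem_append, List.mem_cons] at hx
    rcases hx with h | h | h
    · have := h₅ x h; omega
    · omega
    · have := h₃ x h; omega
  · have l1 := hp.length_eq
    have l2 := hq.length_eq
    simp only [List.length_range, List.length_cons] at l1 l2
    simp [glue]
    omega

/-- Surjectivity of gluing: every letter of `l₁` except its minimum `a` exceeds all of `l₂`, so `a`
and `l₂` together fill the values up to `j`. -/
theorem perm_range_of_append_max_cons {i j : ℕ} {l₁ l₂ : List ℕ}
    (hs : SchroederWord (l₁ ++ (i + j + 1) :: l₂))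
    (hp : (l₁ ++ (i + j + 1) :: l₂).Perm (List.range (i + j + 1 + 1))) (hl : l₁.length = i + 1) :
    ∃ a, l₁ = (l₁.map (· - j)).map (spread j a) ∧ (l₁.map (· - j)).Perm (List.range (i + 1)) ∧
      (a :: l₂).Perm (List.range (j + 1)) := by
  obtain ⟨hn, hm⟩ := perm_range_iff.1 hp
  have hlen := hp.length_eq
  simp only [List.length_append, List.length_cons, List.length_range] at hlen
  rw [List.nodup_append, List.nodup_cons] at hn
  obtain ⟨hn₁, ⟨hM₂, hn₂⟩, hdis⟩ := hn
  have hM₁ : ∀ x ∈ l₁, x < i + j + 1 := by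
    intro x hx
    have h1 := (hm x).1 (by simp [hx])
    have h2 := hdis x hx (i + j + 1) (by simp)
    omega
  obtain ⟨a, ha, hamin⟩ : ∃ a ∈ l₁, ∀ x ∈ l₁, a ≤ x := by
    have hne : l₁.toFinset.Nonempty := by
      rw [List.toFinset_nonempty_iff]
      rintro rfl
      simp at hl
    obtain ⟨a, ha, h⟩ := Finset.exists_min_image l₁.toFinset id hne
    exact ⟨a, by simpa using ha, by simpa using h⟩
  have hkey : ∀ x ∈ l₁, x ≠ a → ∀ z ∈ l₂, z < x := by
    intro x hx hxa z hz
    by_contra hzx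
    have hxz : x < z := by
      have := hdis x hx z (List.mem_cons_of_mem _ hz)
      omega
    have haz : a < z := (hamin x hx).trans_lt hxz
    have hzM : z < i + j + 1 := by
      have h1 := (hm z).1 (by simp [hz])
      have h2 : z ≠ i + j + 1 := fun h => hM₂ (h ▸ hz)
      omega
    have hsub : [i + j + 1, z].Sublist ((i + j + 1) :: l₂) :=
      (List.singleton_sublist.2 hz).cons_cons _
    have hax : [a, x].Sublist l₁ ∨ [x, a].Sublist l₁ := by
      obtain ⟨u, v, rfl⟩ := List.append_of_mem ha
      simp only [List.mem_append, List.mem_cons] at hx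
      rcases hx with h | h | h
      · exact Or.inr ((List.singleton_sublist.2 h).append (List.singleton_sublist.2 (by simp)))
      · exact absurd h hxa
      · exact Or.inl (((List.singleton_sublist.2 h).cons_cons a).trans
          (List.sublist_append_right _ _))
    rcases hax with h | h
    · exact hs a x _ z (h.append hsub) haz hxz hzM
    · exact hs x a _ z (h.append hsub) hxz haz hzM
  have hnd : (a :: l₂).Nodup :=
    List.nodup_cons.2 ⟨fun h => hdis a ha a (List.mem_cons_of_mem _ h) rfl, hn₂⟩
  -- A set of `j + 1` values closed downwards is `{0, …, j}`.
  have hdown : ∀ x ∈ a :: l₂, ∀ y < x, y ∈ a :: l₂ := by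
    intro x hx y hyx
    by_contra hy
    simp only [List.mem_cons, not_or] at hy
    have hxn : x < i + j + 1 + 1 := by
      refine (hm x).1 ?_
      rw [List.mem_append, List.mem_cons]
      rcases List.mem_cons.1 hx with rfl | h
      · exact Or.inl ha
      · exact Or.inr (Or.inr h)
    have hyl := (hm y).2 (by omega)
    simp only [List.mem_append, List.mem_cons] at hyl
    rcases hyl with h | h | h
    · rcases List.mem_cons.1 hx with rfl | hx
      · have := hamin y h; omega
      · have := hkey y h hy.1 x hx; omega
    · omega
    · exact hy.2 h
  have hlen₂ : (a :: l₂).length = j + 1 := by simp only [List.length_cons]; omega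
  have hlow : ∀ x ∈ a :: l₂, x < j + 1 := by
    intro x hx
    have h1 : (List.range (x + 1)).Subperm (a :: l₂) := by
      refine List.Nodup.subperm List.nodup_range fun y hy => ?_
      rcases (Nat.lt_succ_iff_lt_or_eq.1 (List.mem_range.1 hy)) with h | rfl
      · exact hdown x hx y h
      · exact hx
    have := h1.length_le
    rw [List.length_range] at this
    omega
  have hq : (a :: l₂).Perm (List.range (j + 1)) := perm_range_of_lt hnd hlow hlen₂
  have haj : a ≤ j := by have := hlow a (by simp); omega
  have hhigh : ∀ x ∈ l₁, x ≠ a → j < x := by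
    intro x hx hxa
    by_contra hxj
    have := ((perm_range_iff.1 hq).2 x).2 (by omega)
    rcases List.mem_cons.1 this with h | h
    · exact hxa h
    · exact hdis x hx x (List.mem_cons_of_mem _ h) rfl
  have hinv : ∀ x ∈ l₁, spread j a (x - j) = x := by
    intro x hx
    unfold spread
    by_cases hxa : x = a
    · subst hxa
      rw [if_pos (by omega)]
    · have := hhigh x hx hxa
      rw [if_neg (by omega)]
      omega
  refine ⟨a, ?_, perm_range_of_lt ?_ ?_ (by simpa using hl), hq⟩
  · rw [List.map_map]
    conv_lhs => rw [← List.map_id l₁]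
    exact List.map_congr_left fun x hx => (hinv x hx).symm
  · refine List.Nodup.map_on (fun x hx y hy h => ?_) hn₁
    rw [← hinv x hx, ← hinv y hy, h]
  · intro x hx
    obtain ⟨y, hy, rfl⟩ := List.mem_map.1 hx
    have := hM₁ y hy
    change y - j < i + 1
    omega

theorem card_avoiders_max_later {Q : List ℕ → Prop} (hQ : OrderInvariant Q) (i j : ℕ) :
    ({l ∈ avoiders (i + j + 1 + 1) (AppendTop Q) | l.idxOf (i + j + 1) = i + 1} : Finset _).card =
      (avoiders (i + 1) Q).card * (avoiders (j + 1) (AppendTop Q)).card := by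
  rw [← Finset.card_product]
  symm
  have hiff : ∀ {a : ℕ} {p t : List ℕ}, p.Perm (List.range (i + 1)) →
      (a :: t).Perm (List.range (j + 1)) →
      ((SchroederWord (glue i j p (a :: t)) ↔ SchroederWord p ∧ SchroederWord (a :: t)) ∧
        (HasSubword (AppendTop Q) (glue i j p (a :: t)) ↔
          HasSubword Q p ∨ HasSubword (AppendTop Q) (a :: t))) := by
    intro a p t hp hq
    obtain ⟨h₁, h₂, h₃, h₄, h₅⟩ := append_max_cons_conditions hp hq
    have haj : a ≤ j := by have := ((perm_range_iff.1 hq).2 a).1 (by simp); omega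
    have hmono : StrictMonoOn (spread j a) {x | x ∈ p} := (spread_strictMono haj).strictMonoOn _
    simp only [glue, List.headD_cons, List.tail_cons]
    rw [schroederWord_append_max_cons_iff h₁ h₂ h₃ h₄ h₅,
      hasSubword_appendTop_append_max_cons_iff h₁ h₂ h₃ h₄ h₅, schroederWord_map_iff hmono,
      hasSubword_map_iff hQ hmono]
    exact ⟨Iff.rfl, Iff.rfl⟩
  refine Finset.card_bij (fun pq _ => glue i j pq.1 pq.2) ?_ ?_ ?_
  · rintro ⟨p, q⟩ hpq
    simp only [Finset.mem_product, mem_avoiders] at hpq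
    obtain ⟨⟨hp, hps, hpQ⟩, hq, hqs, hqQ⟩ := hpq
    cases q with
    -- `q` has `j + 1` letters, so the default value in `headD` never occurs.
    | nil => simpa using hq.length_eq
    | cons a t =>
      obtain ⟨h₁, h₂, h₃, h₄, h₅⟩ := append_max_cons_conditions hp hq
      simp only [Finset.mem_filter, mem_avoiders]
      refine ⟨⟨glue_perm hp hq, (hiff hp hq).1.2 ⟨hps, hqs⟩,
        mt (hiff hp hq).2.1 (not_or.2 ⟨hpQ, hqQ⟩)⟩, ?_⟩
      simp only [glue, List.headD_cons, List.tail_cons]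
      rw [List.idxOf_append_of_notMem (fun h => absurd (h₅ _ h) (by omega)),
        List.idxOf_cons_self, List.length_map, hp.length_eq, List.length_range, add_zero]
  · rintro ⟨p, q⟩ hpq ⟨p', q'⟩ hpq' h
    simp only [Finset.mem_product, mem_avoiders] at hpq hpq'
    obtain ⟨⟨hp, -, -⟩, hq, -, -⟩ := hpq
    obtain ⟨⟨hp', -, -⟩, hq', -, -⟩ := hpq'
    cases q with
    | nil => simpa using hq.length_eq
    | cons a t =>
    cases q' with
    | nil => simpa using hq'.length_eq
    | cons a' t' =>
    have haj : a ≤ j := by have := ((perm_range_iff.1 hq).2 a).1 (by simp); omega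
    have haj' : a' ≤ j := by have := ((perm_range_iff.1 hq').2 a').1 (by simp); omega
    simp only [glue, List.headD_cons, List.tail_cons] at h
    obtain ⟨h₁, h₂⟩ := List.append_inj h (by simp [hp.length_eq, hp'.length_eq])
    obtain rfl := (List.cons.inj h₂).2
    -- Subtracting `j` recovers the first word without knowing `a`; the image of its letter `0` then
    -- gives `a`.
    have hpp : p = p' := by
      have := congrArg (List.map (· - j)) h₁
      simpa [Function.comp_def, spread_sub haj, spread_sub haj'] using this
    subst hpp
    have h0 : 0 ∈ p := ((perm_range_iff.1 hp).2 0).2 (by omega)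
    have haa := List.map_inj_left.1 h₁ 0 h0
    simp only [spread, if_true] at haa
    rw [haa]
  · intro l hl
    simp only [Finset.mem_filter, mem_avoiders] at hl
    obtain ⟨⟨hp, hs, hQl⟩, hidx⟩ := hl
    have hM : i + j + 1 ∈ l := ((perm_range_iff.1 hp).2 _).2 (by omega)
    obtain ⟨l₁, l₂, rfl, hM₁⟩ := List.eq_append_cons_of_mem hM
    rw [List.idxOf_append_of_notMem hM₁, List.idxOf_cons_self, add_zero] at hidx
    obtain ⟨a, h₁, h₂, h₃⟩ := perm_range_of_append_max_cons hs hp hidx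
    have hg : glue i j (l₁.map (· - j)) (a :: l₂) = l₁ ++ (i + j + 1) :: l₂ := by
      simp only [glue, List.headD_cons, List.tail_cons]
      rw [← h₁]
    obtain ⟨h₄, h₅⟩ := hiff h₂ h₃
    rw [hg] at h₄ h₅
    rw [h₅, not_or] at hQl
    refine ⟨(l₁.map (· - j), a :: l₂), ?_, hg⟩
    simp only [Finset.mem_product, mem_avoiders]
    exact ⟨⟨h₂, (h₄.1 hs).1, hQl.1⟩, h₃, (h₄.1 hs).2, hQl.2⟩

theorem card_avoiders_succ {Q : List ℕ → Prop} (hQ : OrderInvariant Q) (hne : ¬ Q []) (n : ℕ) :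
    (avoiders (n + 1) (AppendTop Q)).card = (avoiders n (AppendTop Q)).card +
      ∑ i ∈ Finset.range n,
        (avoiders (i + 1) Q).card * (avoiders (n - i) (AppendTop Q)).card := by
  -- Index `0` is the separate term. Index `i + 1` leaves `i + 1` letters before the maximum and `n
  -- - i` letters in the second word, which includes the shared one.
  rw [Finset.card_eq_sum_card_fiberwise (f := fun l => l.idxOf n) (t := Finset.range (n + 1)),
    Finset.sum_range_succ', card_avoiders_max_first hne, add_comm]
  · congr 1
    refine Finset.sum_congr rfl fun i hi => ?_
    rw [Finset.mem_range] at hi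
    obtain ⟨j, rfl⟩ : ∃ j, n = i + j + 1 := ⟨n - i - 1, by omega⟩
    rw [card_avoiders_max_later hQ, show i + j + 1 - i = j + 1 by omega]
  · intro l hl
    obtain ⟨hp, -, -⟩ := mem_avoiders.1 hl
    have : n ∈ l := ((perm_range_iff.1 hp).2 n).2 (by omega)
    have h := List.idxOf_lt_length_iff.2 this
    rw [hp.length_eq, List.length_range] at h
    simpa using h

theorem card_avoiders_appendTop_congr {Q R : List ℕ → Prop} (hQ : OrderInvariant Q)
    (hR : OrderInvariant R) (hQn : ¬ Q []) (hRn : ¬ R [])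
    (h : ∀ n, (avoiders n Q).card = (avoiders n R).card) (n : ℕ) :
    (avoiders n (AppendTop Q)).card = (avoiders n (AppendTop R)).card := by
  induction n using Nat.strong_induction_on with
  | _ n ih =>
    cases n with
    | zero =>
      congr 1
      ext l
      simp only [mem_avoiders, List.range_zero, List.perm_nil]
      have : ∀ P : List ℕ → Prop, ¬ HasSubword (AppendTop P) [] := by
        rintro P ⟨s, hs, t, z, rfl, -⟩
        simp at hs
      refine and_congr_right ?_
      rintro rfl
      simp [this]
    | succ n =>
      rw [card_avoiders_succ hQ hQn, card_avoiders_succ hR hRn, ih n (by omega)]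
      congr 1
      refine Finset.sum_congr rfl fun i hi => ?_
      rw [h, ih (n - i) (by omega)]

/-! ### Permutations and patterns as words -/

/-- The letters of the word `s` are in the same relative order as those of `τ`. -/
def PermWord {k : ℕ} (τ : Equiv.Perm (Fin k)) (s : List ℕ) : Prop :=
  ∃ f : Fin k → ℕ, s = List.ofFn f ∧ ∀ a b, f a < f b ↔ τ a < τ b

theorem orderInvariant_permWord {k : ℕ} (τ : Equiv.Perm (Fin k)) : OrderInvariant (PermWord τ) := by
  intro s φ hφ
  constructor
  · rintro ⟨f, hf, h⟩
    have hlen : s.length = k := by simpa using congrArg List.length hf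
    subst hlen
    have hf' : List.ofFn f = List.ofFn fun a => φ (s.get a) := by
      rw [← hf]
      conv_lhs => rw [← List.ofFn_get s]
      rw [List.map_ofFn]
      rfl
    have hf' : ∀ a, f a = φ (s.get a) := congrFun (List.ofFn_injective hf')
    refine ⟨s.get, (List.ofFn_get s).symm, fun a b => ?_⟩
    rw [← h, hf', hf', hφ.lt_iff_lt (List.get_mem _ _) (List.get_mem _ _)]
  · rintro ⟨f, rfl, h⟩
    refine ⟨φ ∘ f, by rw [List.map_ofFn], fun a b => ?_⟩
    rw [← h]
    exact hφ.lt_iff_lt (List.mem_ofFn.2 ⟨a, rfl⟩) (List.mem_ofFn.2 ⟨b, rfl⟩)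

theorem permWord_succ_eq_appendTop {k : ℕ} {τ : Equiv.Perm (Fin k)} {τ' : Equiv.Perm (Fin (k + 1))}
    (h : ∀ a b : Fin k, τ' a.castSucc < τ' b.castSucc ↔ τ a < τ b)
    (hlast : ∀ a : Fin k, τ' a.castSucc < τ' (Fin.last k)) :
    PermWord τ' = AppendTop (PermWord τ) := by
  ext s
  constructor
  · rintro ⟨f, rfl, hf⟩
    refine ⟨List.ofFn fun a => f a.castSucc, f (Fin.last k), ?_, ⟨_, rfl, fun a b => ?_⟩, ?_⟩
    · rw [List.ofFn_succ', List.concat_eq_append]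
    · rw [hf, h]
    · intro x hx
      obtain ⟨a, rfl⟩ := List.mem_ofFn.1 hx
      exact (hf _ _).2 (hlast a)
  · rintro ⟨t, z, rfl, ⟨f, rfl, hf⟩, hz⟩
    have hz' : ∀ a, f a < z := fun a => hz _ (List.mem_ofFn.2 ⟨a, rfl⟩)
    refine ⟨Fin.snoc f z, ?_, fun a b => ?_⟩
    · rw [List.ofFn_succ', List.concat_eq_append]
      simp
    · induction a using Fin.lastCases with
      | last =>
        induction b using Fin.lastCases with
        | last => simp
        | cast b =>
          simp only [Fin.snoc_last, Fin.snoc_castSucc]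
          exact iff_of_false (hz' b).asymm (hlast b).asymm
      | cast a =>
        induction b using Fin.lastCases with
        | last =>
          simp only [Fin.snoc_last, Fin.snoc_castSucc]
          exact iff_of_true (hz' a) (hlast a)
        | cast b =>
          simp only [Fin.snoc_castSucc]
          rw [hf, h]

/-- The word of a permutation. -/
def toWord {n : ℕ} (π : Equiv.Perm (Fin n)) : List ℕ := List.ofFn fun i => (π i : ℕ)

theorem containsPattern_iff {n k : ℕ} (π : Equiv.Perm (Fin n)) (τ : Equiv.Perm (Fin k)) :
    ContainsPattern π τ ↔ HasSubword (PermWord τ) (toWord π) := by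
  constructor
  · rintro ⟨i, hi, h⟩
    refine ⟨List.ofFn fun a => (π (i a) : ℕ), ?_, _, rfl, fun a b => by rw [← h, Fin.lt_def]⟩
    rw [List.sublist_iff_exists_fin_orderEmbedding_get_eq]
    refine ⟨OrderEmbedding.ofStrictMono
      (fun a => Fin.cast (by simp [toWord]) (i (Fin.cast (by simp) a))) ?_, ?_⟩
    · intro a b hab
      exact hi hab
    · intro a
      simp [toWord]
      rfl
  · rintro ⟨s, hs, f, rfl, hf⟩
    obtain ⟨e, he⟩ := List.sublist_iff_exists_fin_orderEmbedding_get_eq.1 hs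
    have hlen : (toWord π).length = n := by simp [toWord]
    refine ⟨fun a => Fin.cast hlen (e (Fin.cast (by simp) a)), ?_, fun a b => ?_⟩
    · intro a b hab
      exact e.strictMono hab
    · have key : ∀ a, f a = π (Fin.cast hlen (e (Fin.cast (by simp) a))) := by
        intro a
        have := he (Fin.cast (by simp) a)
        simp only [List.get_eq_getElem, toWord, List.getElem_ofFn] at this
        exact this
      rw [← hf, key, key, Fin.lt_def]

theorem toWord_injective {n : ℕ} : Function.Injective (toWord (n := n)) := by
  intro π π' h
  ext i
  exact congrFun (List.ofFn_injective h) i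

theorem toWord_perm {n : ℕ} (π : Equiv.Perm (Fin n)) : (toWord π).Perm (List.range n) := by
  refine perm_range_of_lt ?_ ?_ (by simp [toWord])
  · exact List.nodup_ofFn.2 (Fin.val_injective.comp π.injective)
  · intro x hx
    obtain ⟨a, rfl⟩ := List.mem_ofFn.1 hx
    exact (π a).2

theorem exists_toWord_eq {n : ℕ} {l : List ℕ} (hl : l.Perm (List.range n)) :
    ∃ π : Equiv.Perm (Fin n), toWord π = l := by
  have hlen : l.length = n := by simpa using hl.length_eq
  obtain ⟨hn, hm⟩ := perm_range_iff.1 hl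
  subst hlen
  let f : Fin l.length → Fin l.length := fun i => ⟨l.get i, (hm _).1 (List.get_mem _ _)⟩
  have hf : Function.Injective f := fun i j h =>
    List.nodup_iff_injective_get.1 hn (by simpa [f] using h)
  refine ⟨Equiv.ofBijective f (Finite.injective_iff_bijective.1 hf), ?_⟩
  simp only [toWord, Equiv.ofBijective_apply, f]
  exact List.ofFn_get l

theorem permWord_pattern1243_iff {s : List ℕ} :
    PermWord pattern1243 s ↔ ∃ x y d c, s = [x, y, d, c] ∧ x < y ∧ y < c ∧ c < d := by
  constructor
  · rintro ⟨f, rfl, hf⟩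
    refine ⟨f 0, f 1, f 2, f 3, by simp [List.ofFn_succ], ?_, ?_, ?_⟩ <;>
      rw [hf] <;> simp [pattern1243_word]
  · rintro ⟨x, y, d, c, rfl, h₁, h₂, h₃⟩
    refine ⟨![x, y, d, c], by simp [List.ofFn_succ], ?_⟩
    rw [pattern1243_word]
    simp [Fin.forall_fin_succ]
    omega

theorem permWord_pattern2143_iff {s : List ℕ} :
    PermWord pattern2143 s ↔ ∃ x y d c, s = [x, y, d, c] ∧ y < x ∧ x < c ∧ c < d := by
  constructor
  · rintro ⟨f, rfl, hf⟩
    refine ⟨f 0, f 1, f 2, f 3, by simp [List.ofFn_succ], ?_, ?_, ?_⟩ <;>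
      rw [hf] <;> simp [pattern2143_word]
  · rintro ⟨x, y, d, c, rfl, h₁, h₂, h₃⟩
    refine ⟨![x, y, d, c], by simp [List.ofFn_succ], ?_⟩
    rw [pattern2143_word]
    simp [Fin.forall_fin_succ]
    omega

theorem schroederWord_toWord_iff {n : ℕ} (π : Equiv.Perm (Fin n)) :
    SchroederWord (toWord π) ↔ AvoidsPattern π pattern1243 ∧ AvoidsPattern π pattern2143 := by
  rw [AvoidsPattern, AvoidsPattern, containsPattern_iff, containsPattern_iff, ← not_or]
  constructor
  · rintro h (⟨s, hs, hq⟩ | ⟨s, hs, hq⟩)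
    · obtain ⟨x, y, d, c, rfl, h₁, h₂, h₃⟩ := permWord_pattern1243_iff.1 hq
      exact h x y d c hs (by omega) h₂ h₃
    · obtain ⟨x, y, d, c, rfl, h₁, h₂, h₃⟩ := permWord_pattern2143_iff.1 hq
      exact h x y d c hs h₂ (by omega) h₃
  · intro h x y d c hs hx hy hd
    have hxy : x ≠ y := by
      have := hs.nodup (perm_range_iff.1 (toWord_perm π)).1
      simp only [List.nodup_cons, List.mem_cons, not_or] at this
      exact this.1.1
    rcases lt_or_gt_of_ne hxy with hlt | hlt
    · exact h (Or.inl ⟨_, hs, permWord_pattern1243_iff.2 ⟨x, y, d, c, rfl, hlt, hy, hd⟩⟩)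
    · exact h (Or.inr ⟨_, hs, permWord_pattern2143_iff.2 ⟨x, y, d, c, rfl, hlt, hx, hd⟩⟩)

theorem ncard_permsAvoiding {k : ℕ} (τ : Equiv.Perm (Fin k)) (n : ℕ) :
    (permsAvoiding n {⟨4, pattern1243⟩, ⟨4, pattern2143⟩, ⟨k, τ⟩}).ncard =
      (avoiders n (PermWord τ)).card := by
  rw [← Set.ncard_image_of_injective _ toWord_injective, ← Set.ncard_coe_finset]
  congr 1
  have hmem : ∀ π : Equiv.Perm (Fin n),
      π ∈ permsAvoiding n {⟨4, pattern1243⟩, ⟨4, pattern2143⟩, ⟨k, τ⟩} ↔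
        SchroederWord (toWord π) ∧ ¬ HasSubword (PermWord τ) (toWord π) := by
    intro π
    rw [schroederWord_toWord_iff, ← containsPattern_iff]
    simp [permsAvoiding, AvoidsPattern, and_assoc]
  ext l
  simp only [Set.mem_image, Finset.mem_coe, mem_avoiders, hmem]
  constructor
  · rintro ⟨π, h, rfl⟩
    exact ⟨toWord_perm π, h⟩
  · rintro ⟨hp, h⟩
    obtain ⟨π, rfl⟩ := exists_toWord_eq hp
    exact ⟨π, h, rfl⟩

/-! ### The patterns 12⋯k and 213⋯k -/

theorem permWord_patternIncreasing_two_iff {s : List ℕ} :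
    PermWord (patternIncreasing 2) s ↔ ∃ x y, s = [x, y] ∧ x < y := by
  constructor
  · rintro ⟨f, rfl, hf⟩
    refine ⟨f 0, f 1, by simp, ?_⟩
    rw [hf]
    simp [patternIncreasing]
  · rintro ⟨x, y, rfl, h⟩
    refine ⟨![x, y], by simp, ?_⟩
    simp [Fin.forall_fin_two, patternIncreasing]
    omega

theorem permWord_pattern213_two_iff {s : List ℕ} :
    PermWord (pattern213 2) s ↔ ∃ x y, s = [x, y] ∧ y < x := by
  have h0 : pattern213 2 0 = 1 := by decide
  have h1 : pattern213 2 1 = 0 := by decide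
  constructor
  · rintro ⟨f, rfl, hf⟩
    refine ⟨f 0, f 1, by simp, ?_⟩
    rw [hf, h0, h1]
    simp
  · rintro ⟨x, y, rfl, h⟩
    refine ⟨![x, y], by simp, ?_⟩
    simp [Fin.forall_fin_two, h0, h1]
    omega

/-- Reversal exchanges ascents and descents. The Schröder condition is automatic for monotone words,
since 1243 and 2143 each have both an increasing and a decreasing pair. -/
theorem card_avoiders_two (n : ℕ) :
    (avoiders n (PermWord (patternIncreasing 2))).card =
      (avoiders n (PermWord (pattern213 2))).card := by
  have hinc : ∀ {l : List ℕ}, ¬ HasSubword (PermWord (patternIncreasing 2)) l ↔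
      ∀ x y, [x, y].Sublist l → ¬ x < y := fun {l} =>
    ⟨fun h x y hs hxy => h ⟨_, hs, permWord_patternIncreasing_two_iff.2 ⟨x, y, rfl, hxy⟩⟩, by
      rintro h ⟨s, hs, hq⟩
      obtain ⟨x, y, rfl, hxy⟩ := permWord_patternIncreasing_two_iff.1 hq
      exact h x y hs hxy⟩
  have hdec : ∀ {l : List ℕ}, ¬ HasSubword (PermWord (pattern213 2)) l ↔
      ∀ x y, [x, y].Sublist l → ¬ y < x := fun {l} =>
    ⟨fun h x y hs hxy => h ⟨_, hs, permWord_pattern213_two_iff.2 ⟨x, y, rfl, hxy⟩⟩, by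
      rintro h ⟨s, hs, hq⟩
      obtain ⟨x, y, rfl, hxy⟩ := permWord_pattern213_two_iff.1 hq
      exact h x y hs hxy⟩
  have hsub : ∀ {x y : ℕ} {l : List ℕ}, [x, y].Sublist l.reverse ↔ [y, x].Sublist l := by
    intro x y l
    rw [← List.reverse_sublist, List.reverse_reverse]
    rfl
  refine Finset.card_bij (fun l _ => l.reverse) ?_ (fun _ _ _ _ h => List.reverse_injective h) ?_
  · intro l hl
    rw [mem_avoiders, hinc] at hl
    have h2 : ∀ x y, [x, y].Sublist l.reverse → ¬ y < x := fun x y hs => hl.2.2 y x (hsub.1 hs)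
    rw [mem_avoiders, hdec]
    refine ⟨(List.reverse_perm l).trans hl.1, fun x y d c hs _ _ => h2 d c ?_, h2⟩
    exact (List.sublist_append_right [x, y] [d, c]).trans hs
  · intro l hl
    rw [mem_avoiders, hdec] at hl
    have h2 : ∀ x y, [x, y].Sublist l.reverse → ¬ x < y := fun x y hs => hl.2.2 y x (hsub.1 hs)
    refine ⟨l.reverse, ?_, List.reverse_reverse l⟩
    rw [mem_avoiders, hinc]
    refine ⟨(List.reverse_perm l).trans hl.1, fun x y d c hs hx _ => absurd hx (h2 x c ?_), h2⟩
    refine List.Sublist.trans ?_ hs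
    exact (List.singleton_sublist.2 (by simp : c ∈ [y, d, c])).cons_cons x

/-- Holds for every `k`, as needed for monotonicity of avoidance; for `k < 2` there are no two
distinct positions to compare. -/
theorem pattern213_castSucc_lt_iff {k : ℕ} (a b : Fin k) :
    pattern213 (k + 1) a.castSucc < pattern213 (k + 1) b.castSucc ↔
      pattern213 k a < pattern213 k b := by
  by_cases hk : 2 ≤ k
  · have h : ∀ a : Fin k, pattern213 (k + 1) a.castSucc = (pattern213 k a).castSucc := by
      intro a
      simp only [pattern213, hk, dif_pos, show 2 ≤ k + 1 by omega, Equiv.swap_apply_def, Fin.ext_iff,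
        Fin.val_castSucc]
      split_ifs <;> rfl
    rw [h, h, Fin.castSucc_lt_castSucc_iff]
  · have : a = b := by ext; omega
    subst this
    simp

/-- This fails for `k = 1`, where the longer pattern is 21; hence the induction starts at 2. -/
theorem pattern213_castSucc_lt_last {k : ℕ} (hk : 2 ≤ k) (a : Fin k) :
    pattern213 (k + 1) a.castSucc < pattern213 (k + 1) (Fin.last k) := by
  have ha := a.2
  simp only [pattern213, show 2 ≤ k + 1 by omega, dif_pos, Equiv.swap_apply_def, Fin.ext_iff,
    Fin.val_castSucc, Fin.val_last]
  split_ifs <;> simp [Fin.lt_def] <;> omega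

theorem not_permWord_nil {k : ℕ} (τ : Equiv.Perm (Fin k)) (hk : k ≠ 0) : ¬ PermWord τ [] := by
  rintro ⟨f, hf, -⟩
  simpa [eq_comm, hk] using congrArg List.length hf

theorem card_avoiders_eq {k : ℕ} (hk : 2 ≤ k) (n : ℕ) :
    (avoiders n (PermWord (patternIncreasing k))).card =
      (avoiders n (PermWord (pattern213 k))).card := by
  induction k, hk using Nat.le_induction generalizing n with
  | base => exact card_avoiders_two n
  | succ k hk ih =>
    rw [permWord_succ_eq_appendTop (τ := patternIncreasing k) (τ' := patternIncreasing (k + 1))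
        (by simp [patternIncreasing]) (by simp [patternIncreasing, Fin.castSucc_lt_last]),
      permWord_succ_eq_appendTop pattern213_castSucc_lt_iff (pattern213_castSucc_lt_last hk)]
    exact card_avoiders_appendTop_congr (orderInvariant_permWord _) (orderInvariant_permWord _)
      (not_permWord_nil _ (by omega)) (not_permWord_nil _ (by omega)) ih n

theorem wilfEquivalent_increasing_213 (k : ℕ) :
    WilfEquivalent
      {⟨4, pattern1243⟩, ⟨4, pattern2143⟩, ⟨k, patternIncreasing k⟩}
      {⟨4, pattern1243⟩, ⟨4, pattern2143⟩, ⟨k, pattern213 k⟩} := by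
  intro n
  by_cases hk : 2 ≤ k
  · rw [ncard_permsAvoiding, ncard_permsAvoiding, card_avoiders_eq hk]
  · rw [pattern213, dif_neg hk, patternIncreasing]

/-! ### From equal counts to a single bijection -/

theorem AvoidsPattern.succ {n k : ℕ} {π : Equiv.Perm (Fin n)} {τ : Equiv.Perm (Fin k)}
    {τ' : Equiv.Perm (Fin (k + 1))} (h : AvoidsPattern π τ)
    (hτ : ∀ a b : Fin k, τ' a.castSucc < τ' b.castSucc ↔ τ a < τ b) : AvoidsPattern π τ' := by
  rintro ⟨i, hi, h'⟩
  exact h ⟨fun a => i a.castSucc, fun a b hab => hi (Fin.castSucc_lt_castSucc_iff.2 hab),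
    fun a b => by rw [h', hτ]⟩

theorem avoidsPattern_of_lt {n k : ℕ} (h : n < k) (π : Equiv.Perm (Fin n))
    (τ : Equiv.Perm (Fin k)) : AvoidsPattern π τ := by
  rintro ⟨i, hi, -⟩
  have := Fintype.card_le_of_injective i hi.injective
  simp only [Fintype.card_fin] at this
  omega

/-- Two monotone families of predicates on a finite type that hold equally often are related by a
permutation of the type. -/
theorem exists_equiv_of_card_eq {α : Type*} [Finite α] {P P' : ℕ → α → Prop} (N : ℕ)
    (hP : ∀ k x, P k x → P (k + 1) x) (hP' : ∀ k x, P' k x → P' (k + 1) x)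
    (hN : ∀ x, P N x) (hN' : ∀ x, P' N x)
    (hcard : ∀ k, Nat.card {x // P k x} = Nat.card {x // P' k x}) :
    ∃ e : α ≃ α, ∀ k x, P k x ↔ P' k (e x) := by
  classical
  cases nonempty_fintype α
  -- `f` and `g` give the least index at which each family holds; by monotonicity they determine all
  -- the predicates.
  let f : α → ℕ := fun x => Nat.find (p := fun k => P k x) ⟨N, hN x⟩
  let g : α → ℕ := fun x => Nat.find (p := fun k => P' k x) ⟨N, hN' x⟩
  have hf : ∀ k x, P k x ↔ f x ≤ k := fun k x =>
    ⟨fun h => Nat.find_min' _ h, fun h =>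
      Nat.le_induction (Nat.find_spec (⟨N, hN x⟩ : ∃ m, P m x)) (fun m _ => hP m x) k h⟩
  have hg : ∀ k x, P' k x ↔ g x ≤ k := fun k x =>
    ⟨fun h => Nat.find_min' _ h, fun h =>
      Nat.le_induction (Nat.find_spec (⟨N, hN' x⟩ : ∃ m, P' m x)) (fun m _ => hP' m x) k h⟩
  have hle : ∀ k, ({x | f x ≤ k} : Finset α).card = ({x | g x ≤ k} : Finset α).card := by
    intro k
    have := hcard k
    simpa only [hf, hg, Nat.card_eq_fintype_card, Fintype.card_subtype] using this
  have hsplit : ∀ (φ : α → ℕ) k, ({x | φ x ≤ k + 1} : Finset α).card =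
      ({x | φ x ≤ k} : Finset α).card + ({x | φ x = k + 1} : Finset α).card := by
    intro φ k
    rw [← Finset.card_union_of_disjoint]
    · congr 1
      ext x
      simp
      omega
    · rw [Finset.disjoint_filter]
      intro x _ h
      omega
  have heq : ∀ k, Fintype.card {x // f x = k} = Fintype.card {x // g x = k} := by
    intro k
    rw [Fintype.card_subtype, Fintype.card_subtype]
    cases k with
    | zero => simpa using hle 0
    | succ k =>
      have h1 := hsplit f k
      have h2 := hsplit g k
      have h3 := hle k
      have h4 := hle (k + 1)
      omega
  -- Fibres of equal size are matched arbitrarily, and the matchings are assembled over all `k`.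
  let e : ∀ k, {x // f x = k} ≃ {x // g x = k} := fun k => Fintype.equivOfCardEq (heq k)
  refine ⟨(Equiv.sigmaFiberEquiv f).symm.trans
    ((Equiv.sigmaCongrRight e).trans (Equiv.sigmaFiberEquiv g)), fun k x => ?_⟩
  rw [hf, hg]
  have : g (e (f x) ⟨x, rfl⟩) = f x := (e (f x) ⟨x, rfl⟩).2
  simp only [Equiv.trans_apply, Equiv.sigmaFiberEquiv, Equiv.coe_fn_mk, Equiv.coe_fn_symm_mk,
    Equiv.sigmaCongrRight_apply]
  rw [this]

theorem card_subtype_permsAvoiding {n k : ℕ} (τ : Equiv.Perm (Fin k)) :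
    Nat.card {π : permsAvoiding n schroederPatterns // AvoidsPattern (π : Equiv.Perm (Fin n)) τ} =
      (permsAvoiding n {⟨4, pattern1243⟩, ⟨4, pattern2143⟩, ⟨k, τ⟩}).ncard := by
  rw [← Nat.card_coe_set_eq]
  refine Nat.card_congr ((Equiv.subtypeSubtypeEquivSubtypeInter
    (· ∈ permsAvoiding n schroederPatterns) (AvoidsPattern · τ)).trans (Equiv.subtypeEquivRight fun π => ?_))
  simp [permsAvoiding, schroederPatterns, and_assoc]

theorem corollary3p4 :
    (∀ n : ℕ, ∃ ω : permsAvoiding n schroederPatterns ≃ permsAvoiding n schroederPatterns,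
      ∀ k : ℕ, 1 ≤ k → ∀ π : permsAvoiding n schroederPatterns,
        AvoidsPattern (π : Equiv.Perm (Fin n)) (patternIncreasing k) ↔
          AvoidsPattern (ω π : Equiv.Perm (Fin n)) (pattern213 k)) ∧
    (∀ k : ℕ, 1 ≤ k →
      WilfEquivalent
        {⟨4, pattern1243⟩, ⟨4, pattern2143⟩, ⟨k, patternIncreasing k⟩}
        {⟨4, pattern1243⟩, ⟨4, pattern2143⟩, ⟨k, pattern213 k⟩}) := by
  refine ⟨fun n => ?_, fun k _ => wilfEquivalent_increasing_213 k⟩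
  -- The bound `n + 1` works because a pattern longer than the permutation is always avoided.
  obtain ⟨ω, hω⟩ := exists_equiv_of_card_eq
    (α := permsAvoiding n schroederPatterns)
    (P := fun k π => AvoidsPattern (π : Equiv.Perm (Fin n)) (patternIncreasing k))
    (P' := fun k π => AvoidsPattern (π : Equiv.Perm (Fin n)) (pattern213 k)) (n + 1)
    (fun k π h => h.succ (by simp [patternIncreasing]))
    (fun k π h => h.succ pattern213_castSucc_lt_iff)
    (fun π => avoidsPattern_of_lt (by omega) _ _) (fun π => avoidsPattern_of_lt (by omega) _ _)
    (fun k => by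
      rw [card_subtype_permsAvoiding, card_subtype_permsAvoiding]
      exact wilfEquivalent_increasing_213 k n)
  exact ⟨ω, fun k _ π => hω k π⟩
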